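/- Let $R$ be an associative unital ring, $\mathcal F_l$ a Gabriel filter of left ideals and $\mathcal F_r$ a Gabriel filter of right ideals of $R$. Let ${}_l\mathcal F_r$ be the induced symmetric filter: the Gabriel filter of all right ideals of $R\otimes_{\mathbb Z}R^{op}$ that contain $J\otimes R^{op}+R\otimes I$ for some $I\in\mathcal F_l$, $J\in\mathcal F_r$. An $R$-bimodule $M$ is regarded as a right $R\otimes_{\mathbb Z}R^{op}$-module by $x(r\otimes s)=sxr$. Let ${}_l\mathcal T_r(M)$ be its torsion submodule, i.e. the set of those $x\in M$ with $\{t\in R\otimes_{\mathbb Z} R^{op}: xt=0\}\in{}_l\mathcal F_r$; $M$ is torsion-free if ${}_l\mathcal T_r(M)=0$. Let $${}_lM_r=\varinjlim_{K\in{}_l\mathcal F_r}\mathrm{Hom}_{R\otimes R^{op}}\bigl(K,\,M/{}_l\mathcal T_r(M)\bigr)$$ be the symmetric module of quotients, and $q_M:M\to{}_lM_r$ the canonical map, which sends $x$ to the class of the homomorphism $t\mapsto xt+{}_l\mathcal T_r(M)$ on $K=R\otimes_{\mathbb Z} R^{op}$. For a derivation $\delta$ of $R$, a $\delta$-derivation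 of an $R$-bimodule $M$ is an additive map $d:M\to M$ with $d(xr)=d(x)r+x\delta(r)$ and $d(rx)=\delta(r)x+rd(x)$ for all $x\in M$, $r\in R$. An extension of $d$ to ${}_lM_r$ is a $\delta$-derivation $d'$ of the bimodule ${}_lM_r$ with $d'q_M=q_Md$. Let $\overline\delta$ be the derivation of $R\otimes_{\mathbb Z}R^{op}$ given by $\overline\delta(r\otimes s)=\delta(r)\otimes s+r\otimes\delta(s)$. The filter ${}_l\mathcal F_r$ is called differential if for every derivation $\delta$ of $R$ and every $I\in{}_l\mathcal F_r$ there is $J\in{}_l\mathcal F_r$ with $\overline\delta(J)\subseteq I$. **Theorem.** Let $\delta$ be a derivation of $R$, $M$ an $R$-bimodule and $d$ a $\delta$-derivation of $M$. 1. If $M$ is torsion-free, then $d$ has an extension to ${}_lM_r$. 2. If $d({}_l\mathcal T_r(M))\subseteq{}_l\mathcal T_r(M)$, then $d$ has an extension to ${}_lM_r$. 3. Any two extensions of $d$ to ${}_lM_r$ are equal. 4. The filter ${}_l\mathcal F_r$ is differential if and only if for every $R$-bimodule $N$, every derivation $\delta'$ of $R$ and every $\delta'$-derivation $d'$ of $N$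 there is exactly one extension of $d'$ to ${}_lN_r$. -/

import Mathlib

universe u w

open scoped TensorProduct
open MulOpposite (op unop)

noncomputable section

/-! ### One-sided Gabriel filters -/

/-- A Gabriel filter of left ideals of `R`. Here `I.comap (LinearMap.mulRight R a)` is the left
ideal `(I : a) = {r | r * a ∈ I}`. -/
structure LeftGabrielFilter (R : Type*) [Ring R] where
  sets : Set (Submodule R R)
  top_mem : ⊤ ∈ sets
  mem_of_le : ∀ I ∈ sets, ∀ J, I ≤ J → J ∈ sets
  inf_mem : ∀ I ∈ sets, ∀ J ∈ sets, I ⊓ J ∈ sets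
  colon_mem : ∀ I ∈ sets, ∀ a : R, I.comap (LinearMap.mulRight R a) ∈ sets
  trans_mem : ∀ I ∈ sets, ∀ J : Submodule R R,
    (∀ a ∈ I, J.comap (LinearMap.mulRight R a) ∈ sets) → J ∈ sets

/-- A Gabriel filter of right ideals of `R`; a right ideal is a submodule of `R` for the action of
`Rᵐᵒᵖ` by right multiplication. Here `I.comap (LinearMap.mulLeft Rᵐᵒᵖ a)` is the right ideal
`(I : a) = {r | a * r ∈ I}`. -/
structure RightGabrielFilter (R : Type*) [Ring R] where
  sets : Set (Submodule Rᵐᵒᵖ R)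
  top_mem : ⊤ ∈ sets
  mem_of_le : ∀ I ∈ sets, ∀ J, I ≤ J → J ∈ sets
  inf_mem : ∀ I ∈ sets, ∀ J ∈ sets, I ⊓ J ∈ sets
  colon_mem : ∀ I ∈ sets, ∀ a : R, I.comap (LinearMap.mulLeft Rᵐᵒᵖ a) ∈ sets
  trans_mem : ∀ I ∈ sets, ∀ J : Submodule Rᵐᵒᵖ R,
    (∀ a ∈ I, J.comap (LinearMap.mulLeft Rᵐᵒᵖ a) ∈ sets) → J ∈ sets

/-! ### Torsion submodule and module of quotients of a right module -/

namespace RightGabrielFilter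

variable {E : Type*} [Ring E] {N : Type*} [AddCommGroup N] [Module Eᵐᵒᵖ N]

/-- For `x` in a right `E`-module, the homomorphism of right modules `E → N`, `t ↦ x t`. -/
def orbitMap (x : N) : E →ₗ[Eᵐᵒᵖ] N where
  toFun t := op t • x
  map_add' s t := by simp [add_smul]
  map_smul' e t := by
    induction e using MulOpposite.rec'
    simp [mul_smul]

/-- The right annihilator `{t | x t = 0}`, a right ideal of `E`. -/
def rightAnn (x : N) : Submodule Eᵐᵒᵖ E := LinearMap.ker (orbitMap x)

theorem mem_rightAnn (x : N) (t : E) : t ∈ rightAnn x ↔ op t • x = 0 := Iff.rfl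

variable (F : RightGabrielFilter E)

/-- The torsion submodule: the elements whose right annihilator belongs to the filter. -/
def torsion (N : Type*) [AddCommGroup N] [Module Eᵐᵒᵖ N] : Submodule Eᵐᵒᵖ N where
  carrier := {x | rightAnn x ∈ F.sets}
  zero_mem' := F.mem_of_le ⊤ F.top_mem _ fun t _ => by simp [mem_rightAnn]
  add_mem' {x y} hx hy := F.mem_of_le _ (F.inf_mem _ hx _ hy) _ fun t ht => by
    obtain ⟨h₁, h₂⟩ := ht
    have h₁ : op t • x = 0 := h₁
    have h₂ : op t • y = 0 := h₂
    simp [mem_rightAnn, h₁, h₂]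
  smul_mem' c x hx := F.mem_of_le _ (F.colon_mem _ hx (unop c)) _ fun t ht => by
    have h : op (unop c * t) • x = 0 := ht
    simpa [mem_rightAnn, mul_smul] using h

/-- The right ideals in the filter, directed by reverse inclusion. -/
structure Index where
  ideal : Submodule Eᵐᵒᵖ E
  mem : ideal ∈ F.sets

instance : Preorder F.Index where
  le K L := L.ideal ≤ K.ideal
  le_refl K := le_refl K.ideal
  le_trans _ _ _ h₁ h₂ := le_trans (α := Submodule Eᵐᵒᵖ E) h₂ h₁

instance : DecidableEq F.Index := Classical.decEq _

instance : Nonempty F.Index := ⟨⟨⊤, F.top_mem⟩⟩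

instance : IsDirectedOrder F.Index :=
  ⟨fun K L => ⟨⟨K.ideal ⊓ L.ideal, F.inf_mem _ K.mem _ L.mem⟩,
    inf_le_left (α := Submodule Eᵐᵒᵖ E), inf_le_right (α := Submodule Eᵐᵒᵖ E)⟩⟩

/-- `Hom_E(K, N / 𝒯(N))`. -/
abbrev PartialHom (N : Type*) [AddCommGroup N] [Module Eᵐᵒᵖ N] (K : F.Index) : Type _ :=
  K.ideal →ₗ[Eᵐᵒᵖ] (N ⧸ F.torsion N)

instance (K : F.Index) : AddCommGroup (F.PartialHom N K) := LinearMap.addCommGroup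

instance (K : F.Index) : AddCommMonoid (F.PartialHom N K) := AddCommGroup.toAddCommMonoid

/-- Restriction of homomorphisms from `K` to a smaller right ideal `L` of the filter. -/
def restrict (N : Type*) [AddCommGroup N] [Module Eᵐᵒᵖ N] (K L : F.Index) (h : K ≤ L) :
    F.PartialHom N K →+ F.PartialHom N L where
  toFun f := f.comp (Submodule.inclusion h)
  map_zero' := rfl
  map_add' _ _ := rfl

instance : DirectedSystem (F.PartialHom N) fun K L h => F.restrict N K L h where
  map_self _ _ := rfl
  map_map _ _ _ _ _ _ := rfl

/-- The module of quotients `N_F`: the direct limit of `Hom_E(K, N / 𝒯(N))` over all `K` in the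
filter. -/
def ModuleOfQuotients (N : Type*) [AddCommGroup N] [Module Eᵐᵒᵖ N] : Type _ :=
  AddCommGroup.DirectLimit (F.PartialHom N) (F.restrict N)

instance : AddCommGroup (F.ModuleOfQuotients N) :=
  inferInstanceAs (AddCommGroup (AddCommGroup.DirectLimit (F.PartialHom N) (F.restrict N)))

namespace ModuleOfQuotients

/-- The class of a homomorphism `K → N / 𝒯(N)` in the module of quotients. -/
def of (K : F.Index) : F.PartialHom N K →+ F.ModuleOfQuotients N :=
  AddCommGroup.DirectLimit.of (F.PartialHom N) (F.restrict N) K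

theorem of_restrict {K L : F.Index} (h : K ≤ L) (f : F.PartialHom N K) :
    of F L (F.restrict N K L h f) = of F K f :=
  AddCommGroup.DirectLimit.of_f h f

theorem exists_of (y : F.ModuleOfQuotients N) : ∃ K f, y = of F K f :=
  AddCommGroup.DirectLimit.induction_on y fun K f => ⟨K, f, rfl⟩

/-- Two homomorphisms define the same class if they agree on some right ideal of the filter. -/
theorem of_eq_of {K L P : F.Index} (hK : K ≤ P) (hL : L ≤ P) {f : F.PartialHom N K}
    {g : F.PartialHom N L} (h : ∀ t (ht : t ∈ P.ideal), f ⟨t, hK ht⟩ = g ⟨t, hL ht⟩) :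
    of F K f = of F L g := by
  rw [← of_restrict F hK, ← of_restrict F hL]
  congr 1
  ext ⟨t, ht⟩
  exact h t ht

/-- The right ideal `(K : e) = {t | e * t ∈ K}`. -/
def colon (K : F.Index) (e : E) : F.Index :=
  ⟨K.ideal.comap (LinearMap.mulLeft Eᵐᵒᵖ e), F.colon_mem _ K.mem e⟩

/-- For `f : K → N / 𝒯(N)` and `e : E`, the homomorphism `(K : e) → N / 𝒯(N)`, `t ↦ f (e * t)`. -/
def precomp (e : E) (K : F.Index) : F.PartialHom N K →+ F.PartialHom N (colon F K e) where
  toFun f := f.comp ((LinearMap.mulLeft Eᵐᵒᵖ e).restrict (p := (colon F K e).ideal) (q := K.ideal)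
    fun _ ht => ht)
  map_zero' := rfl
  map_add' _ _ := rfl

theorem precomp_apply (e : E) (K : F.Index) (f : F.PartialHom N K) (t : E)
    (ht : t ∈ (colon F K e).ideal) : precomp F e K f ⟨t, ht⟩ = f ⟨e * t, ht⟩ := rfl

/-- Right multiplication by `e` on the module of quotients: `(f e)(t) = f (e * t)`. -/
def mulRight (e : E) : F.ModuleOfQuotients N →+ F.ModuleOfQuotients N :=
  AddCommGroup.DirectLimit.lift (F.PartialHom N) (F.restrict N) _
    (fun K => (of F (colon F K e)).comp (precomp F e K))
    (fun _ L h _ => of_eq_of F (P := colon F L e) (le_refl _)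
      (Submodule.comap_mono (f := LinearMap.mulLeft Eᵐᵒᵖ e) h) fun _ _ => rfl)

theorem mulRight_of (e : E) (K : F.Index) (f : F.PartialHom N K) :
    mulRight F e (of F K f) = of F (colon F K e) (precomp F e K f) :=
  AddCommGroup.DirectLimit.lift_of _ _ _ _ _

/-- The right action of `E` on the module of quotients as a ring homomorphism. -/
def action : Eᵐᵒᵖ →+* AddMonoid.End (F.ModuleOfQuotients N) where
  toFun e := mulRight F (unop e)
  map_one' := by
    ext y
    obtain ⟨K, f, rfl⟩ := exists_of F y
    change mulRight F 1 (of F K f) = of F K f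
    rw [mulRight_of]
    refine of_eq_of F (P := K) (fun t ht => ?_) (le_refl _) fun t ht => ?_
    · change 1 * t ∈ K.ideal
      rwa [one_mul]
    · rw [precomp_apply]
      congr 2
      exact one_mul t
  map_zero' := by
    ext y
    obtain ⟨K, f, rfl⟩ := exists_of F y
    change mulRight F 0 (of F K f) = 0
    rw [mulRight_of, ← map_zero (of F K)]
    refine of_eq_of F (P := K) (fun t _ => ?_) (le_refl _) fun t ht => ?_
    · change 0 * t ∈ K.ideal
      rw [zero_mul]
      exact zero_mem _
    · rw [precomp_apply, LinearMap.zero_apply, ← map_zero f]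
      congr 2
      exact zero_mul t
  map_mul' a b := by
    ext y
    obtain ⟨K, f, rfl⟩ := exists_of F y
    change mulRight F (unop b * unop a) (of F K f) = mulRight F (unop a) (mulRight F (unop b)
      (of F K f))
    rw [mulRight_of, mulRight_of, mulRight_of]
    have key : ∀ t, unop b * unop a * t = unop b * (unop a * t) := fun t => mul_assoc _ _ _
    refine of_eq_of F (P := colon F K (unop b * unop a)) (le_refl _) (fun t ht => ?_)
      fun t ht => ?_
    · change unop b * (unop a * t) ∈ K.ideal
      rw [← key]
      exact ht
    · change f ⟨unop b * unop a * t, _⟩ = f ⟨unop b * (unop a * t), _⟩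
      congr 2
      exact key t
  map_add' a b := by
    ext y
    obtain ⟨K, f, rfl⟩ := exists_of F y
    change mulRight F (unop a + unop b) (of F K f) = mulRight F (unop a) (of F K f) +
      mulRight F (unop b) (of F K f)
    rw [mulRight_of, mulRight_of, mulRight_of]
    let P : F.Index := ⟨(colon F K (unop a)).ideal ⊓ (colon F K (unop b)).ideal,
      F.inf_mem _ (colon F K _).mem _ (colon F K _).mem⟩
    have ha : colon F K (unop a) ≤ P := inf_le_left (α := Submodule Eᵐᵒᵖ E)
    have hb : colon F K (unop b) ≤ P := inf_le_right (α := Submodule Eᵐᵒᵖ E)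
    rw [← of_restrict F ha, ← of_restrict F hb, ← map_add]
    refine of_eq_of F (P := P) (fun t ht => ?_) (le_refl _) fun t ht => ?_
    · change (unop a + unop b) * t ∈ K.ideal
      rw [add_mul]
      exact add_mem (ha ht) (hb ht)
    · rw [precomp_apply]
      change _ = f ⟨unop a * t, ha ht⟩ + f ⟨unop b * t, hb ht⟩
      rw [← map_add]
      congr 2
      exact add_mul _ _ t

instance : Module Eᵐᵒᵖ (F.ModuleOfQuotients N) := Module.compHom _ (action F (N := N))

theorem smul_of (e : Eᵐᵒᵖ) (K : F.Index) (f : F.PartialHom N K) :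
    e • of F K f = of F (colon F K (unop e)) (precomp F (unop e) K f) :=
  mulRight_of F (unop e) K f

/-- The canonical map `q_N`: `x` is sent to the class of `E → N / 𝒯(N)`, `t ↦ x t + 𝒯(N)`. -/
def q : N →ₗ[Eᵐᵒᵖ] F.ModuleOfQuotients N where
  toFun x := of F ⟨⊤, F.top_mem⟩ ((F.torsion N).mkQ ∘ₗ orbitMap x ∘ₗ Submodule.subtype ⊤)
  map_add' x y := by
    rw [← map_add]
    congr 1
    ext t
    simp [orbitMap]
  map_smul' e x := by
    rw [RingHom.id_apply, smul_of]
    refine of_eq_of F (P := ⟨⊤, F.top_mem⟩) (le_refl _) (fun _ _ => Submodule.mem_top) fun t ht => ?_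
    change (F.torsion N).mkQ (op t • e • x) = (F.torsion N).mkQ (op (unop e * t) • x)
    simp [mul_smul]

end ModuleOfQuotients

end RightGabrielFilter

/-! ### Bimodules as right modules over `R ⊗ Rᵒᵖ` -/

/-- The ring `R ⊗_ℤ Rᵒᵖ`. -/
abbrev Env (R : Type*) [Ring R] : Type _ := R ⊗[ℤ] Rᵐᵒᵖ

section Bimodule

variable (R : Type*) [Ring R] (M : Type*) [AddCommGroup M] [Module R M] [Module Rᵐᵒᵖ M]
  [SMulCommClass R Rᵐᵒᵖ M]

/-- The ring homomorphism `R ⊗ Rᵒᵖ → End_ℤ(M)ᵒᵖ` sending `r ⊗ s` to `x ↦ s x r`. -/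
def bimoduleAction : Env R →ₐ[ℤ] (Module.End ℤ M)ᵐᵒᵖ :=
  Algebra.TensorProduct.lift
    (((Module.toModuleEnd ℤ (S := Rᵐᵒᵖ) M).op.comp (RingEquiv.opOp R).toRingHom).toIntAlgHom)
    ((Module.toModuleEnd ℤ (S := R) M).op.toIntAlgHom)
    (fun r s => by
      apply MulOpposite.unop_injective
      ext x
      exact smul_comm (unop s) (op r) x)

/-- The `R`-bimodule `M` regarded as a right module over `R ⊗ Rᵒᵖ`. -/
@[nolint unusedArguments]
def AsRight (_ : Type*) (M : Type*) : Type _ := M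

instance : AddCommGroup (AsRight R M) := inferInstanceAs (AddCommGroup M)

/-- The identity map from `M` to `M` regarded as a right module over `R ⊗ Rᵒᵖ`. -/
def AsRight.of : M ≃+ AsRight R M := AddEquiv.refl M

instance : Module (Env R)ᵐᵒᵖ (AsRight R M) :=
  letI : Module (Module.End ℤ M) (AsRight R M) := inferInstanceAs (Module (Module.End ℤ M) M)
  Module.compHom (AsRight R M)
    ((RingEquiv.opOp (Module.End ℤ M)).symm.toRingHom.comp (bimoduleAction R M).toRingHom.op)

/-- `x (r ⊗ s) = s x r`. -/
theorem AsRight.tmul_smul (x : M) (r s : R) :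
    (op (r ⊗ₜ[ℤ] op s) : (Env R)ᵐᵒᵖ) • AsRight.of R M x = AsRight.of R M (s • op r • x) := by
  change (unop (bimoduleAction R M (r ⊗ₜ[ℤ] op s))) x = s • op r • x
  exact congrArg (fun φ : (Module.End ℤ M)ᵐᵒᵖ => (unop φ) x)
    (Algebra.TensorProduct.lift_tmul _ _ _ r (op s))

end Bimodule

/-! ### The symmetric filter -/

section SymmetricFilter

variable {R : Type*} [Ring R]

/-- The right ideal `J ⊗ Rᵒᵖ + R ⊗ I` of `R ⊗ Rᵒᵖ`, for a right ideal `J` and a left ideal `I`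
of `R`. -/
def tensorIdeal (J : Submodule Rᵐᵒᵖ R) (I : Submodule R R) : Submodule (Env R)ᵐᵒᵖ (Env R) :=
  Submodule.span _ {t | ∃ j ∈ J, ∃ s : R, t = j ⊗ₜ[ℤ] op s} ⊔
    Submodule.span _ {t | ∃ r : R, ∃ i ∈ I, t = r ⊗ₜ[ℤ] op i}

theorem tensorIdeal_le {J : Submodule Rᵐᵒᵖ R} {I : Submodule R R}
    {K : Submodule (Env R)ᵐᵒᵖ (Env R)} :
    tensorIdeal J I ≤ K ↔ (∀ j ∈ J, ∀ s : R, j ⊗ₜ[ℤ] op s ∈ K) ∧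
      (∀ r : R, ∀ i ∈ I, r ⊗ₜ[ℤ] op i ∈ K) := by
  simp only [tensorIdeal, sup_le_iff, Submodule.span_le]
  constructor
  · rintro ⟨h₁, h₂⟩
    exact ⟨fun j hj s => h₁ ⟨j, hj, s, rfl⟩, fun r i hi => h₂ ⟨r, i, hi, rfl⟩⟩
  · rintro ⟨h₁, h₂⟩
    refine ⟨?_, ?_⟩
    · rintro _ ⟨j, hj, s, rfl⟩
      exact h₁ j hj s
    · rintro _ ⟨r, i, hi, rfl⟩
      exact h₂ r i hi

theorem mul_mem_of_mem_right {K : Submodule (Env R)ᵐᵒᵖ (Env R)} {a : Env R} (ha : a ∈ K)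
    (b : Env R) : a * b ∈ K :=
  K.smul_mem (op b) ha

/-- The symmetric filter induced by a left and a right Gabriel filter: the right ideals of
`R ⊗ Rᵒᵖ` that contain `J ⊗ Rᵒᵖ + R ⊗ I` for some `I` in the left filter and some `J` in the right
filter. It is a Gabriel filter. -/
def symmetricFilter (Fl : LeftGabrielFilter R) (Fr : RightGabrielFilter R) :
    RightGabrielFilter (Env R) where
  sets := {K | ∃ I ∈ Fl.sets, ∃ J ∈ Fr.sets, tensorIdeal J I ≤ K}
  top_mem := ⟨⊤, Fl.top_mem, ⊤, Fr.top_mem, le_top⟩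
  mem_of_le := by
    rintro K ⟨I, hI, J, hJ, h⟩ L hKL
    exact ⟨I, hI, J, hJ, h.trans hKL⟩
  inf_mem := by
    rintro K ⟨I, hI, J, hJ, h⟩ K' ⟨I', hI', J', hJ', h'⟩
    refine ⟨I ⊓ I', Fl.inf_mem _ hI _ hI', J ⊓ J', Fr.inf_mem _ hJ _ hJ', ?_⟩
    rw [tensorIdeal_le] at h h' ⊢
    exact ⟨fun j hj s => ⟨h.1 j hj.1 s, h'.1 j hj.2 s⟩,
      fun r i hi => ⟨h.2 r i hi.1, h'.2 r i hi.2⟩⟩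
  colon_mem := by
    rintro K ⟨I, hI, J, hJ, h⟩ e
    rw [tensorIdeal_le] at h
    suffices hs : ∃ I ∈ Fl.sets, ∃ J ∈ Fr.sets, (∀ j ∈ J, ∀ s : R, e * j ⊗ₜ[ℤ] op s ∈ K) ∧
        (∀ r : R, ∀ i ∈ I, e * r ⊗ₜ[ℤ] op i ∈ K) by
      obtain ⟨I', hI', J', hJ', hs⟩ := hs
      exact ⟨I', hI', J', hJ', tensorIdeal_le.2 hs⟩
    induction e using TensorProduct.induction_on with
    | zero =>
      refine ⟨⊤, Fl.top_mem, ⊤, Fr.top_mem, ?_, ?_⟩ <;> intros <;> rw [zero_mul] <;>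
        exact zero_mem _
    | tmul a b =>
      refine ⟨_, Fl.colon_mem I hI (unop b), _, Fr.colon_mem J hJ a, fun j hj s => ?_,
        fun r i hi => ?_⟩
      · rw [Algebra.TensorProduct.tmul_mul_tmul]
        exact h.1 _ hj (s * unop b)
      · rw [Algebra.TensorProduct.tmul_mul_tmul]
        exact h.2 _ (i * unop b) hi
    | add e₁ e₂ h₁ h₂ =>
      obtain ⟨I₁, hI₁, J₁, hJ₁, h₁⟩ := h₁
      obtain ⟨I₂, hI₂, J₂, hJ₂, h₂⟩ := h₂
      refine ⟨_, Fl.inf_mem _ hI₁ _ hI₂, _, Fr.inf_mem _ hJ₁ _ hJ₂, fun j hj s => ?_,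
        fun r i hi => ?_⟩
      · rw [add_mul]
        exact add_mem (h₁.1 j hj.1 s) (h₂.1 j hj.2 s)
      · rw [add_mul]
        exact add_mem (h₁.2 r i hi.1) (h₂.2 r i hi.2)
  trans_mem := by
    rintro K ⟨I, hI, J, hJ, h⟩ L hL
    rw [tensorIdeal_le] at h
    let A : Submodule Rᵐᵒᵖ R :=
      { carrier := {r | r ⊗ₜ[ℤ] (1 : Rᵐᵒᵖ) ∈ L}
        zero_mem' := by simp
        add_mem' := fun {a b} ha hb => by
          change (a + b) ⊗ₜ[ℤ] (1 : Rᵐᵒᵖ) ∈ L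
          rw [TensorProduct.add_tmul]
          exact add_mem ha hb
        smul_mem' := fun c a ha => by
          simpa [Algebra.TensorProduct.tmul_mul_tmul] using
            mul_mem_of_mem_right ha (unop c ⊗ₜ[ℤ] (1 : Rᵐᵒᵖ)) }
    let B : Submodule R R :=
      { carrier := {r | (1 : R) ⊗ₜ[ℤ] op r ∈ L}
        zero_mem' := by simp
        add_mem' := fun {a b} ha hb => by
          change (1 : R) ⊗ₜ[ℤ] (op a + op b) ∈ L
          rw [TensorProduct.tmul_add]
          exact add_mem ha hb
        smul_mem' := fun c a ha => by
          simpa [Algebra.TensorProduct.tmul_mul_tmul] using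
            mul_mem_of_mem_right ha ((1 : R) ⊗ₜ[ℤ] op c) }
    refine ⟨B, Fl.trans_mem I hI B fun i hi => ?_, A, Fr.trans_mem J hJ A fun j hj => ?_, ?_⟩
    · obtain ⟨I', hI', J', hJ', h'⟩ := hL _ (h.2 1 i hi)
      rw [tensorIdeal_le] at h'
      refine Fl.mem_of_le I' hI' _ fun b hb => ?_
      have := h'.2 1 b hb
      rw [Submodule.mem_comap, LinearMap.mulLeft_apply,
        Algebra.TensorProduct.tmul_mul_tmul, one_mul] at this
      exact this
    · obtain ⟨I', hI', J', hJ', h'⟩ := hL _ (h.1 j hj 1)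
      rw [tensorIdeal_le] at h'
      refine Fr.mem_of_le J' hJ' _ fun b hb => ?_
      have := h'.1 b hb 1
      rw [Submodule.mem_comap, LinearMap.mulLeft_apply,
        Algebra.TensorProduct.tmul_mul_tmul, MulOpposite.op_one, one_mul] at this
      exact this
    · rw [tensorIdeal_le]
      refine ⟨fun j hj s => ?_, fun r i hi => ?_⟩
      · simpa [Algebra.TensorProduct.tmul_mul_tmul] using
          mul_mem_of_mem_right (show j ⊗ₜ[ℤ] (1 : Rᵐᵒᵖ) ∈ L from hj) ((1 : R) ⊗ₜ[ℤ] op s)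
      · simpa [Algebra.TensorProduct.tmul_mul_tmul] using
          mul_mem_of_mem_right (show (1 : R) ⊗ₜ[ℤ] op i ∈ L from hi) (r ⊗ₜ[ℤ] (1 : Rᵐᵒᵖ))

end SymmetricFilter

/-! ### Symmetric torsion and symmetric module of quotients of a bimodule -/

section SymmetricQuotient

variable {R : Type*} [Ring R] (Fl : LeftGabrielFilter R) (Fr : RightGabrielFilter R)
  (M : Type*) [AddCommGroup M] [Module R M] [Module Rᵐᵒᵖ M] [SMulCommClass R Rᵐᵒᵖ M]

/-- The torsion submodule of the bimodule `M` for the torsion theory of the symmetric filter. -/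
def symmetricTorsion : AddSubgroup M :=
  ((symmetricFilter Fl Fr).torsion (AsRight R M)).toAddSubgroup.comap
    (AsRight.of R M).toAddMonoidHom

/-- The symmetric module of quotients of the bimodule `M`. -/
def SymmetricQuotient : Type _ := (symmetricFilter Fl Fr).ModuleOfQuotients (AsRight R M)

namespace SymmetricQuotient

instance : AddCommGroup (SymmetricQuotient Fl Fr M) :=
  inferInstanceAs (AddCommGroup ((symmetricFilter Fl Fr).ModuleOfQuotients (AsRight R M)))

instance : Module (Env R)ᵐᵒᵖ (SymmetricQuotient Fl Fr M) :=
  inferInstanceAs (Module (Env R)ᵐᵒᵖ ((symmetricFilter Fl Fr).ModuleOfQuotients (AsRight R M)))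

/-- The left action of `R`: `s y = y (1 ⊗ s)`. -/
instance : Module R (SymmetricQuotient Fl Fr M) :=
  Module.compHom _
    (((Algebra.TensorProduct.includeRight : Rᵐᵒᵖ →ₐ[ℤ] Env R).toRingHom.op).comp
      (RingEquiv.opOp R).toRingHom)

/-- The right action of `R`: `y r = y (r ⊗ 1)`. -/
instance : Module Rᵐᵒᵖ (SymmetricQuotient Fl Fr M) :=
  Module.compHom _ ((Algebra.TensorProduct.includeLeft : R →ₐ[ℤ] Env R).toRingHom.op)

theorem left_smul_def (s : R) (y : SymmetricQuotient Fl Fr M) :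
    s • y = (op ((1 : R) ⊗ₜ[ℤ] op s) : (Env R)ᵐᵒᵖ) • y := rfl

theorem right_smul_def (r : R) (y : SymmetricQuotient Fl Fr M) :
    op r • y = (op (r ⊗ₜ[ℤ] (1 : Rᵐᵒᵖ)) : (Env R)ᵐᵒᵖ) • y := rfl

instance : SMulCommClass R Rᵐᵒᵖ (SymmetricQuotient Fl Fr M) where
  smul_comm s r y := by
    induction r using MulOpposite.rec'
    rw [left_smul_def, right_smul_def, right_smul_def, left_smul_def, ← mul_smul, ← mul_smul,
      ← MulOpposite.op_mul, ← MulOpposite.op_mul]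
    simp [Algebra.TensorProduct.tmul_mul_tmul]

/-- The canonical map `q_M` from `M` to its symmetric module of quotients. -/
def q : M →+ SymmetricQuotient Fl Fr M :=
  (RightGabrielFilter.ModuleOfQuotients.q (symmetricFilter Fl Fr)
    (N := AsRight R M)).toAddMonoidHom.comp (AsRight.of R M).toAddMonoidHom

end SymmetricQuotient

end SymmetricQuotient

/-! ### Derivations -/

/-- A derivation `R → R` of a (not necessarily commutative) ring. -/
structure RingDerivation (R : Type*) [Ring R] extends R →+ R where
  leibniz' : ∀ r s, toFun (r * s) = toFun r * s + r * toFun s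

instance (R : Type*) [Ring R] : CoeFun (RingDerivation R) fun _ => R → R := ⟨fun δ => δ.toFun⟩

/-- `d` is a `δ`-derivation of the `R`-bimodule `M`; the right action `x r` is `op r • x`. -/
structure IsBimoduleDerivation {R M : Type*} [Ring R] [AddCommGroup M] [Module R M]
    [Module Rᵐᵒᵖ M] (δ : RingDerivation R) (d : M →+ M) : Prop where
  right : ∀ (x : M) (r : R), d (op r • x) = op r • d x + op (δ r) • x
  left : ∀ (r : R) (x : M), d (r • x) = δ r • x + r • d x

/-- `d'` is a `δ`-derivation of the symmetric module of quotients of `M` that extends `d`, that is,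
`d' ∘ q_M = q_M ∘ d`. -/
def IsExtension {R M : Type*} [Ring R] [AddCommGroup M] [Module R M] [Module Rᵐᵒᵖ M]
    [SMulCommClass R Rᵐᵒᵖ M] (Fl : LeftGabrielFilter R) (Fr : RightGabrielFilter R)
    (δ : RingDerivation R) (d : M →+ M)
    (d' : SymmetricQuotient Fl Fr M →+ SymmetricQuotient Fl Fr M) : Prop :=
  IsBimoduleDerivation δ d' ∧
    ∀ x, d' (SymmetricQuotient.q Fl Fr M x) = SymmetricQuotient.q Fl Fr M (d x)

section EnvDerivation

variable {R : Type*} [Ring R] (δ : RingDerivation R)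

/-- The derivation `δ` as an additive map on `Rᵒᵖ`. -/
def RingDerivation.opHom : Rᵐᵒᵖ →+ Rᵐᵒᵖ where
  toFun r := op (δ (unop r))
  map_zero' := congrArg op δ.map_zero'
  map_add' r s := congrArg op (δ.map_add' (unop r) (unop s))

/-- The additive map `r ⊗ s ↦ δ(r) ⊗ s + r ⊗ δ(s)` of `R ⊗ Rᵒᵖ`. -/
def RingDerivation.envHom : Env R →+ Env R :=
  (TensorProduct.map δ.toAddMonoidHom.toIntLinearMap LinearMap.id +
    TensorProduct.map LinearMap.id δ.opHom.toIntLinearMap : Env R →ₗ[ℤ] Env R).toAddMonoidHom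

theorem RingDerivation.envHom_tmul (r s : R) :
    δ.envHom (r ⊗ₜ[ℤ] op s) = δ r ⊗ₜ[ℤ] op s + r ⊗ₜ[ℤ] op (δ s) := rfl

/-- The derivation of `R ⊗ Rᵒᵖ` determined by a derivation `δ` of `R`. -/
def RingDerivation.env : RingDerivation (Env R) where
  toAddMonoidHom := δ.envHom
  leibniz' x y := by
    change δ.envHom (x * y) = δ.envHom x * y + x * δ.envHom y
    induction x using TensorProduct.induction_on with
    | zero => simp
    | add x₁ x₂ h₁ h₂ =>
      rw [add_mul, map_add, map_add, h₁, h₂, add_mul, add_mul]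
      abel
    | tmul a b =>
      induction y using TensorProduct.induction_on with
      | zero => simp
      | add y₁ y₂ h₁ h₂ =>
        rw [mul_add, map_add, map_add, h₁, h₂, mul_add, mul_add]
        abel
      | tmul c e =>
        induction b using MulOpposite.rec'
        rename_i b
        induction e using MulOpposite.rec'
        rename_i e
        have h₁ : δ (a * c) = δ a * c + a * δ c := δ.leibniz' a c
        have h₂ : δ (e * b) = δ e * b + e * δ b := δ.leibniz' e b
        rw [Algebra.TensorProduct.tmul_mul_tmul, ← MulOpposite.op_mul, envHom_tmul, envHom_tmul,
          envHom_tmul, h₁, h₂]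
        simp only [add_mul, mul_add, Algebra.TensorProduct.tmul_mul_tmul, TensorProduct.add_tmul,
          TensorProduct.tmul_add, MulOpposite.op_add, MulOpposite.op_mul]
        abel

end EnvDerivation

/-- The symmetric filter is differential: for every derivation `δ` of `R` and every `I` in the
filter there is `J` in the filter that the derivation of `R ⊗ Rᵒᵖ` determined by `δ` maps
into `I`. -/
def IsDifferentialFilter {R : Type*} [Ring R] (Fl : LeftGabrielFilter R)
    (Fr : RightGabrielFilter R) : Prop :=
  ∀ δ : RingDerivation R, ∀ I ∈ (symmetricFilter Fl Fr).sets,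
    ∃ J ∈ (symmetricFilter Fl Fr).sets, ∀ t ∈ J, δ.env t ∈ I

end

noncomputable section

/-! The bimodule statement is the case `E = R ⊗ Rᵒᵖ`, `D = δ.env` of a statement about a right
`E`-module `N`, a Gabriel filter `F`, a derivation `D` of `E` and a `D`-derivation `d` of `N`.

Three facts about the module of quotients do the work: the kernel of `q` is the torsion submodule
(`q_eq_zero_iff`), each element is carried into the image of `q` by an ideal of the filter
(`exists_smul_eq_q`), and the module is torsion-free and injective relative to the filter
(`eq_zero_of_smul_eq_zero`, `exists_smul_eq`). If `y t = q x`, the Leibniz rule forces `d'(y) t = q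
(d x) - y D(t)`. When `d` preserves torsion, the right side does not depend on `x` and is linear in
`t`, so injectivity yields a value `d'(y)` and torsion-freeness makes it unique; additivity and the
Leibniz rule for `d'` follow from this uniqueness. Two extensions of the same `d` differ by a linear
map that kills the image of `q`, hence by zero, with no condition on torsion.

Conversely, an extension forces `d` to preserve the kernel of `q`, so the last equivalence asks when
every derivation preserves torsion. A differential filter suffices: restrict to `t` with `x t = 0`
and `x D(t) = 0`. For necessity, let `X` be a variable with `X e = e X - D(e)`; multiplication by
`X` is a derivation of the skew polynomials over `E ⧸ I`. The class `a` of `1` is torsion, so `a X`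
is torsion as well, and the constant term of `(a X) t = (a t) X - a D(t)` shows that `D` maps the
annihilator of `a X` into `I` (`exists_map_mem`). -/

theorem RingDerivation.map_one_eq_zero {R : Type*} [Ring R] (δ : RingDerivation R) :
    δ 1 = 0 := by
  have h : δ (1 * 1) = δ 1 * 1 + 1 * δ 1 := δ.leibniz' 1 1
  rwa [mul_one, mul_one, one_mul, left_eq_add] at h

/-! ### Torsion-freeness and injectivity of the module of quotients -/

namespace RightGabrielFilter

variable {E : Type*} [Ring E] {N : Type*} [AddCommGroup N] [Module Eᵐᵒᵖ N]
  (F : RightGabrielFilter E)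

/-- An element is torsion as soon as a right ideal of the filter moves it into the torsion
submodule. -/
theorem mem_torsion_of_smul_mem {K : Submodule Eᵐᵒᵖ E} (hK : K ∈ F.sets) {x : N}
    (h : ∀ t ∈ K, op t • x ∈ F.torsion N) : x ∈ F.torsion N := by
  refine F.trans_mem K hK _ fun t ht => F.mem_of_le _ (h t ht) _ fun s hs => ?_
  have hs : op s • op t • x = 0 := hs
  change op (t * s) • x = 0
  rwa [MulOpposite.op_mul, mul_smul]

namespace ModuleOfQuotients

/-- A class vanishes in the direct limit only if it already vanishes on some ideal of the filter;
there `x t` is torsion, and transitivity of the filter makes `x` torsion. -/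
theorem q_eq_zero_iff {x : N} : q F x = 0 ↔ x ∈ F.torsion N := by
  constructor
  · intro h
    obtain ⟨K, hK, h⟩ := AddCommGroup.DirectLimit.of.zero_exact _ _ h
    refine F.mem_torsion_of_smul_mem K.mem fun t ht => ?_
    exact (Submodule.Quotient.mk_eq_zero _).1 (LinearMap.congr_fun h ⟨t, ht⟩)
  · intro h
    rw [← map_zero (of F ⟨⊤, F.top_mem⟩)]
    refine of_eq_of F (le_refl _) (le_refl _) fun t _ => ?_
    exact (Submodule.Quotient.mk_eq_zero _).2 (Submodule.smul_mem _ (op t) h)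

theorem q_eq_q_iff {x y : N} : q F x = q F y ↔ x - y ∈ F.torsion N := by
  rw [← sub_eq_zero, ← map_sub, q_eq_zero_iff]

/-- If `x` represents `f t`, then `[f] t = q x`. -/
theorem smul_of_eq_q {K : F.Index} {f : F.PartialHom N K} {t : E} (ht : t ∈ K.ideal) {x : N}
    (hx : (F.torsion N).mkQ x = f ⟨t, ht⟩) : op t • of F K f = q F x := by
  have hmem : ∀ s : E, t * s ∈ K.ideal := fun s => K.ideal.smul_mem (op s) ht
  rw [smul_of]
  refine of_eq_of F (P := ⟨⊤, F.top_mem⟩) (fun s _ => hmem s) (le_refl _) fun s _ => ?_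
  change f ⟨t * s, _⟩ = (F.torsion N).mkQ (op s • x)
  rw [map_smul, hx, ← map_smul]
  rfl

/-- A domain of definition of a representing homomorphism serves as `K`. -/
theorem exists_smul_eq_q (y : F.ModuleOfQuotients N) :
    ∃ K ∈ F.sets, ∀ t ∈ K, ∃ x, op t • y = q F x := by
  obtain ⟨K, f, rfl⟩ := exists_of F y
  refine ⟨K.ideal, K.mem, fun t ht => ?_⟩
  obtain ⟨x, hx⟩ := (F.torsion N).mkQ_surjective (f ⟨t, ht⟩)
  exact ⟨x, smul_of_eq_q F ht hx⟩

/-- The module of quotients is torsion-free. -/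
theorem eq_zero_of_smul_eq_zero {K : Submodule Eᵐᵒᵖ E} (hK : K ∈ F.sets)
    {y : F.ModuleOfQuotients N} (h : ∀ t ∈ K, op t • y = 0) : y = 0 := by
  obtain ⟨L, f, rfl⟩ := exists_of F y
  rw [← map_zero (of F L)]
  refine of_eq_of F (P := ⟨K ⊓ L.ideal, F.inf_mem _ hK _ L.mem⟩) (fun t ht => ht.2)
    (fun t ht => ht.2) fun t ht => ?_
  obtain ⟨x, hx⟩ := (F.torsion N).mkQ_surjective (f ⟨t, ht.2⟩)
  rw [LinearMap.zero_apply, ← hx, Submodule.mkQ_apply, Submodule.Quotient.mk_eq_zero,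
    ← q_eq_zero_iff, ← smul_of_eq_q F ht.2 hx, h t ht.1]

theorem eq_of_smul_eq {K : Submodule Eᵐᵒᵖ E} (hK : K ∈ F.sets)
    {y z : F.ModuleOfQuotients N} (h : ∀ t ∈ K, op t • y = op t • z) : y = z :=
  sub_eq_zero.1 <| eq_zero_of_smul_eq_zero F hK fun t ht => by rw [smul_sub, h t ht, sub_self]

/-- The module of quotients is injective relative to the right ideals of the filter. -/
theorem exists_smul_eq {K : Submodule Eᵐᵒᵖ E} (hK : K ∈ F.sets)
    (g : K →ₗ[Eᵐᵒᵖ] F.ModuleOfQuotients N) :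
    ∃ z, ∀ t (ht : t ∈ K), op t • z = g ⟨t, ht⟩ := by
  let qbar : (N ⧸ F.torsion N) →ₗ[Eᵐᵒᵖ] F.ModuleOfQuotients N :=
    (F.torsion N).liftQ (q F) fun x hx => (q_eq_zero_iff F).2 hx
  have hinj : Function.Injective qbar := by
    rw [← LinearMap.ker_eq_bot]
    exact Submodule.ker_liftQ_eq_bot _ _ _ fun x hx => (q_eq_zero_iff F).1 hx
  -- `L` consists of the `t` in `K` at which `g` already takes values in the copy of `N / 𝒯(N)`; on
  -- it `g` is an honest element of the direct system.
  let L : Submodule Eᵐᵒᵖ E := ((LinearMap.range qbar).comap g).map K.subtype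
  have hLK : L ≤ K := Submodule.map_subtype_le _ _
  have hgL : ∀ t (ht : t ∈ L), g ⟨t, hLK ht⟩ ∈ LinearMap.range qbar := by
    rintro _ ⟨t, ht, rfl⟩
    exact ht
  have hmemL : ∀ t (ht : t ∈ K), g ⟨t, ht⟩ ∈ LinearMap.range qbar → t ∈ L :=
    fun t ht h => ⟨⟨t, ht⟩, h, rfl⟩
  -- `(L : t)` contains the ideal that carries `g t` into the image of `q`, so transitivity puts `L`
  -- in the filter.
  have hcolon : ∀ t (ht : t ∈ K), L.comap (LinearMap.mulLeft Eᵐᵒᵖ t) ∈ F.sets := by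
    intro t ht
    obtain ⟨P, hP, h⟩ := exists_smul_eq_q F (g ⟨t, ht⟩)
    refine F.mem_of_le P hP _ fun s hs => hmemL _ (K.smul_mem (op s) ht) ?_
    obtain ⟨x, hx⟩ := h s hs
    refine ⟨(F.torsion N).mkQ x, ?_⟩
    change q F x = g (op s • ⟨t, ht⟩)
    rw [map_smul, hx]
  have hL : L ∈ F.sets := F.trans_mem K hK L hcolon
  let f : L →ₗ[Eᵐᵒᵖ] (N ⧸ F.torsion N) := (LinearEquiv.ofInjective qbar hinj).symm.toLinearMap ∘ₗ
    (g ∘ₗ Submodule.inclusion hLK).codRestrict _ fun t => hgL t.1 t.2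
  have hf : ∀ t, qbar (f t) = g (Submodule.inclusion hLK t) := fun t =>
    congrArg Subtype.val ((LinearEquiv.ofInjective qbar hinj).apply_symm_apply
      ⟨g (Submodule.inclusion hLK t), hgL t.1 t.2⟩)
  have hz : ∀ t (ht : t ∈ L), op t • of F ⟨L, hL⟩ f = g ⟨t, hLK ht⟩ := by
    intro t ht
    obtain ⟨x, hx⟩ := (F.torsion N).mkQ_surjective (f ⟨t, ht⟩)
    rw [smul_of_eq_q F (K := ⟨L, hL⟩) ht hx]
    refine Eq.trans ?_ (hf ⟨t, ht⟩)
    rw [← hx]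
    rfl
  -- The class represents `g` on `L` only. For `t` in `K`, both sides agree after multiplication by
  -- any element of `(L : t)`, and torsion-freeness removes that factor.
  refine ⟨of F ⟨L, hL⟩ f, fun t ht => eq_of_smul_eq F (hcolon t ht) fun s hs => ?_⟩
  rw [← mul_smul, ← MulOpposite.op_mul, hz (t * s) hs, ← map_smul]
  rfl

/-- An additive map of the module of quotients that commutes with the action and vanishes on the
image of `q` is zero. -/
theorem eq_zero_of_comp_q_eq_zero {h : F.ModuleOfQuotients N → F.ModuleOfQuotients N}
    (hsmul : ∀ (t : E) y, h (op t • y) = op t • h y) (hq : ∀ x, h (q F x) = 0)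
    (y : F.ModuleOfQuotients N) : h y = 0 := by
  obtain ⟨K, hK, hy⟩ := exists_smul_eq_q F y
  refine eq_zero_of_smul_eq_zero F hK fun t ht => ?_
  obtain ⟨x, hx⟩ := hy t ht
  rw [← hsmul, hx, hq]

end ModuleOfQuotients

end RightGabrielFilter

/-! ### Extending derivations of right modules -/

/-- `d` is a `D`-derivation of the right `E`-module `N`. -/
def IsRightDerivation {E N : Type*} [Ring E] [AddCommGroup N] [Module Eᵐᵒᵖ N]
    (D : RingDerivation E) (d : N →+ N) : Prop :=
  ∀ (x : N) (t : E), d (op t • x) = op t • d x + op (D t) • x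

namespace RightGabrielFilter

variable {E : Type*} [Ring E] {N : Type*} [AddCommGroup N] [Module Eᵐᵒᵖ N]
  (F : RightGabrielFilter E) {D : RingDerivation E} {d : N →+ N}

namespace ModuleOfQuotients

/-- `z` is a possible value at `y` of an extension of `d` to the module of quotients. -/
def IsDerivValue (D : RingDerivation E) (d : N →+ N) (y z : F.ModuleOfQuotients N) : Prop :=
  ∃ K ∈ F.sets, ∀ t ∈ K, ∃ x, op t • y = q F x ∧ op t • z = q F (d x) - op (D t) • y

variable {F}

theorem IsDerivValue.add {y y' z z' : F.ModuleOfQuotients N} (h : IsDerivValue F D d y z)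
    (h' : IsDerivValue F D d y' z') : IsDerivValue F D d (y + y') (z + z') := by
  obtain ⟨K, hK, h⟩ := h
  obtain ⟨K', hK', h'⟩ := h'
  refine ⟨_, F.inf_mem _ hK _ hK', fun t ht => ?_⟩
  obtain ⟨x, hx, hz⟩ := h t ht.1
  obtain ⟨x', hx', hz'⟩ := h' t ht.2
  refine ⟨x + x', by rw [smul_add, hx, hx', map_add], ?_⟩
  rw [smul_add, hz, hz', map_add, map_add, smul_add]
  abel

/-- The element `x` with `y t = q x` is determined only modulo torsion, so `q (d x)` is well defined
exactly because `d` preserves torsion. -/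
theorem IsDerivValue.eq (hT : ∀ x ∈ F.torsion N, d x ∈ F.torsion N)
    {y z z' : F.ModuleOfQuotients N} (h : IsDerivValue F D d y z)
    (h' : IsDerivValue F D d y z') : z = z' := by
  obtain ⟨K, hK, h⟩ := h
  obtain ⟨K', hK', h'⟩ := h'
  refine eq_of_smul_eq F (F.inf_mem _ hK _ hK') fun t ht => ?_
  obtain ⟨x, hx, hz⟩ := h t ht.1
  obtain ⟨x', hx', hz'⟩ := h' t ht.2
  rw [hz, hz', (q_eq_q_iff F (x := d x) (y := d x')).2]
  rw [← map_sub]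
  exact hT _ ((q_eq_q_iff F).1 (hx.symm.trans hx'))

/-- On `(K : e)` the term `y D(e) t` of `y D(e t)` cancels against the summand `op (D e) • y`. With
uniqueness of values this is the Leibniz rule for the extension. -/
theorem IsDerivValue.smul {y z : F.ModuleOfQuotients N} (h : IsDerivValue F D d y z) (e : E) :
    IsDerivValue F D d (op e • y) (op e • z + op (D e) • y) := by
  obtain ⟨K, hK, h⟩ := h
  refine ⟨_, F.colon_mem K hK e, fun t ht => ?_⟩
  obtain ⟨x, hx, hz⟩ := h (e * t) ht
  have hD : D (e * t) = D e * t + e * D t := D.leibniz' e t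
  refine ⟨x, by rw [← mul_smul, ← MulOpposite.op_mul, hx], ?_⟩
  rw [smul_add, ← mul_smul, ← MulOpposite.op_mul, hz, hD, ← mul_smul, ← mul_smul,
    ← MulOpposite.op_mul, ← MulOpposite.op_mul, MulOpposite.op_add, add_smul]
  abel

theorem isDerivValue_q (hd : IsRightDerivation D d) (x : N) :
    IsDerivValue F D d (q F x) (q F (d x)) := by
  refine ⟨⊤, F.top_mem, fun t _ => ⟨op t • x, (map_smul _ _ _).symm, ?_⟩⟩
  rw [hd x t, map_add, map_smul, map_smul, add_sub_cancel_right]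

/-- The prescribed products with `t` form a linear map on `K`, which relative injectivity realizes
as multiplication of a single element. -/
theorem exists_isDerivValue (hd : IsRightDerivation D d)
    (hT : ∀ x ∈ F.torsion N, d x ∈ F.torsion N) (y : F.ModuleOfQuotients N) :
    ∃ z, IsDerivValue F D d y z := by
  obtain ⟨K, hK, h⟩ := exists_smul_eq_q F y
  choose! x hx using h
  -- The chosen `x t` need not be additive or linear in `t`, but `q (x t) = y t` is; `hdq` transfers
  -- this to `q (d (x t))`.
  have hdq : ∀ {a b : N}, q F a = q F b → q F (d a) = q F (d b) := fun {a b} hab => by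
    rw [q_eq_q_iff, ← map_sub]
    exact hT _ ((q_eq_q_iff F).1 hab)
  let g : K →ₗ[Eᵐᵒᵖ] F.ModuleOfQuotients N :=
    { toFun := fun t => q F (d (x t)) - op (D t) • y
      map_add' := fun s t => by
        have h₁ : q F (d (x (s + t : K))) = q F (d (x s + x t)) := hdq <| by
          rw [map_add, ← hx _ s.2, ← hx _ t.2, ← hx _ (s + t).2, ← add_smul]
          rfl
        have h₂ : D ((s + t : K) : E) = D s + D t := D.map_add' s t
        rw [h₁, h₂, map_add, map_add, MulOpposite.op_add, add_smul]
        abel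
      map_smul' := fun e t => by
        induction e using MulOpposite.rec'
        rename_i e
        have h₁ : q F (d (x (op e • t : K))) = q F (d (op e • x t)) := hdq <| by
          rw [map_smul, ← hx _ t.2, ← hx _ (op e • t).2, ← mul_smul]
          rfl
        have h₂ : D ((op e • t : K) : E) = D t * e + t * D e := D.leibniz' t e
        rw [h₁, h₂, hd, map_add, map_smul, map_smul, MulOpposite.op_add, add_smul,
          MulOpposite.op_mul, MulOpposite.op_mul, mul_smul, mul_smul, hx _ t.2, RingHom.id_apply,
          smul_sub]
        abel }
  obtain ⟨z, hz⟩ := exists_smul_eq F hK g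
  exact ⟨z, K, hK, fun t ht => ⟨x t, hx t ht, hz t ht⟩⟩

/-- A derivation that preserves torsion extends to the module of quotients. -/
theorem exists_extension (hd : IsRightDerivation D d)
    (hT : ∀ x ∈ F.torsion N, d x ∈ F.torsion N) :
    ∃ d' : F.ModuleOfQuotients N →+ F.ModuleOfQuotients N,
      IsRightDerivation D d' ∧ ∀ x, d' (q F x) = q F (d x) := by
  choose d' hd' using exists_isDerivValue hd hT
  refine ⟨AddMonoidHom.mk' d' fun y y' => ?_, fun y t => ?_, fun x => ?_⟩
  · exact (hd' _).eq hT ((hd' y).add (hd' y'))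
  · exact (hd' _).eq hT ((hd' y).smul t)
  · exact (hd' _).eq hT (isDerivValue_q hd x)

end ModuleOfQuotients

/-- If `x t = 0` and `x D(t) = 0`, the Leibniz rule leaves `d(x) t = 0`. -/
theorem map_torsion_of_differential {D : RingDerivation E} {d : N →+ N}
    (hF : ∀ I ∈ F.sets, ∃ J ∈ F.sets, ∀ t ∈ J, D t ∈ I) (hd : IsRightDerivation D d) {x : N}
    (hx : x ∈ F.torsion N) : d x ∈ F.torsion N := by
  obtain ⟨J, hJ, h⟩ := hF _ hx
  refine F.mem_of_le _ (F.inf_mem _ hx _ hJ) _ fun t ht => ?_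
  have h₁ : op t • x = 0 := ht.1
  have h₂ : op (D t) • x = 0 := h t ht.2
  have := hd x t
  rw [h₁, h₂, map_zero, add_zero] at this
  exact this.symm

end RightGabrielFilter

/-! ### Differential polynomial modules -/

/-- Polynomials in a skew variable with coefficients in a right `E`-module `A`; the variable `X`
satisfies `X e = e X - D e`. -/
@[nolint unusedArguments]
def SkewPoly {E : Type*} [Ring E] (_ : RingDerivation E) (A : Type*) [AddCommGroup A] : Type _ :=
  ℕ →₀ A

namespace SkewPoly

variable {E : Type*} [Ring E] (D : RingDerivation E) (A : Type*) [AddCommGroup A]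

instance : AddCommGroup (SkewPoly D A) := inferInstanceAs (AddCommGroup (ℕ →₀ A))

/-- The monomial `a X ^ n`. -/
def monomial (n : ℕ) : A →+ SkewPoly D A := Finsupp.singleAddHom n

/-- Multiplication by the variable from the right. -/
def shift : SkewPoly D A →+ SkewPoly D A :=
  Finsupp.liftAddHom fun n => monomial D A (n + 1)

/-- The coefficient of `X ^ n`. -/
def coeff (n : ℕ) : SkewPoly D A →+ A := Finsupp.applyAddHom n

variable {D A}

theorem shift_monomial (n : ℕ) (a : A) : shift D A (monomial D A n a) = monomial D A (n + 1) a :=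
  Finsupp.liftAddHom_apply_single _ _ _

theorem coeff_monomial_self (n : ℕ) (a : A) : coeff D A n (monomial D A n a) = a :=
  Finsupp.single_eq_same

theorem coeff_monomial_of_ne {m n : ℕ} (h : m ≠ n) (a : A) :
    coeff D A m (monomial D A n a) = 0 :=
  Finsupp.single_eq_of_ne h

theorem hom_ext {B : Type*} [AddCommGroup B] {f g : SkewPoly D A →+ B}
    (h₀ : ∀ a, f (monomial D A 0 a) = g (monomial D A 0 a))
    (h : ∀ n, (∀ a, f (monomial D A n a) = g (monomial D A n a)) →
      ∀ a, f (shift D A (monomial D A n a)) = g (shift D A (monomial D A n a))) : f = g := by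
  refine Finsupp.addHom_ext fun n a => ?_
  change f (monomial D A n a) = g (monomial D A n a)
  induction n generalizing a with
  | zero => exact h₀ a
  | succ n ih =>
    rw [← shift_monomial]
    exact h n ih a

variable [Module Eᵐᵒᵖ A]

variable (D A) in
/-- The product `(a X ^ n) e` as a function of `a`. -/
def monomialMul : ℕ → E → A →+ SkewPoly D A
  | 0, e => (monomial D A 0).comp (DistribSMul.toAddMonoidHom A (op e))
  | n + 1, e => (shift D A).comp (monomialMul n e) - monomialMul n (D e)

variable (D A) in
/-- The right action of `e`. -/
def mulRight (e : E) : SkewPoly D A →+ SkewPoly D A :=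
  Finsupp.liftAddHom fun n => monomialMul D A n e

theorem mulRight_monomial (e : E) (n : ℕ) (a : A) :
    mulRight D A e (monomial D A n a) = monomialMul D A n e a :=
  Finsupp.liftAddHom_apply_single _ _ _

theorem mulRight_monomial_zero (e : E) (a : A) :
    mulRight D A e (monomial D A 0 a) = monomial D A 0 (op e • a) :=
  mulRight_monomial e 0 a

theorem mulRight_shift (e : E) (p : SkewPoly D A) :
    mulRight D A e (shift D A p) = shift D A (mulRight D A e p) - mulRight D A (D e) p := by
  suffices h : (mulRight D A e).comp (shift D A) =
      (shift D A).comp (mulRight D A e) - mulRight D A (D e) from DFunLike.congr_fun h p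
  refine Finsupp.addHom_ext fun n a => ?_
  change mulRight D A e (shift D A (monomial D A n a)) =
    shift D A (mulRight D A e (monomial D A n a)) - mulRight D A (D e) (monomial D A n a)
  rw [shift_monomial, mulRight_monomial, mulRight_monomial, mulRight_monomial]
  rfl

theorem mulRight_add (e e' : E) : mulRight D A (e + e') = mulRight D A e + mulRight D A e' := by
  -- The scalars are quantified inside the induction on the degree, since the step also needs the
  -- hypothesis at `D e` and `D e'`.
  suffices h : ∀ n e e' a, mulRight D A (e + e') (monomial D A n a) =
      mulRight D A e (monomial D A n a) + mulRight D A e' (monomial D A n a) from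
    Finsupp.addHom_ext fun n a => h n e e' a
  intro n
  induction n with
  | zero =>
    intro e e' a
    rw [mulRight_monomial_zero, mulRight_monomial_zero, mulRight_monomial_zero,
      MulOpposite.op_add, add_smul, map_add]
  | succ n ih =>
    intro e e' a
    have hD : D (e + e') = D e + D e' := D.map_add' e e'
    rw [← shift_monomial, mulRight_shift, mulRight_shift, mulRight_shift, hD, ih, ih, map_add]
    abel

theorem mulRight_zero : mulRight D A 0 = 0 := by
  have h := mulRight_add (D := D) (A := A) 0 0
  rwa [add_zero, left_eq_add] at h

theorem mulRight_one : mulRight D A 1 = AddMonoidHom.id _ := by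
  refine hom_ext (fun a => ?_) fun n ih a => ?_
  · rw [mulRight_monomial_zero, MulOpposite.op_one, one_smul]
    rfl
  · rw [mulRight_shift, ih, D.map_one_eq_zero, mulRight_zero]
    exact sub_zero _

/-- Moving `X` past `e` and then past `e'` produces the correction terms for `D e` and `D e'`; these
match `D (e * e')` by the Leibniz rule. -/
theorem mulRight_mul (e e' : E) (p : SkewPoly D A) :
    mulRight D A (e * e') p = mulRight D A e' (mulRight D A e p) := by
  suffices h : ∀ n e e' a, mulRight D A (e * e') (monomial D A n a) =
      mulRight D A e' (mulRight D A e (monomial D A n a)) from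
    DFunLike.congr_fun (f := mulRight D A (e * e')) (g := (mulRight D A e').comp (mulRight D A e))
      (Finsupp.addHom_ext fun n a => h n e e' a) p
  intro n
  induction n with
  | zero =>
    intro e e' a
    rw [mulRight_monomial_zero, mulRight_monomial_zero, mulRight_monomial_zero,
      MulOpposite.op_mul, mul_smul]
  | succ n ih =>
    intro e e' a
    have hD : D (e * e') = D e * e' + e * D e' := D.leibniz' e e'
    rw [← shift_monomial, mulRight_shift, mulRight_shift, map_sub, mulRight_shift, hD,
      mulRight_add, AddMonoidHom.add_apply, ih, ih, ih]
    abel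

instance : Module Eᵐᵒᵖ (SkewPoly D A) where
  smul e p := mulRight D A (unop e) p
  one_smul p := DFunLike.congr_fun mulRight_one p
  mul_smul e e' p := mulRight_mul (unop e') (unop e) p
  smul_zero e := map_zero (mulRight D A (unop e))
  smul_add e p p' := map_add (mulRight D A (unop e)) p p'
  add_smul e e' p := DFunLike.congr_fun (mulRight_add (unop e) (unop e')) p
  zero_smul p := DFunLike.congr_fun mulRight_zero p

theorem smul_monomial_zero (e : E) (a : A) :
    op e • monomial D A 0 a = monomial D A 0 (op e • a) :=
  mulRight_monomial_zero e a

theorem smul_shift (e : E) (p : SkewPoly D A) :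
    op e • shift D A p = shift D A (op e • p) - op (D e) • p :=
  mulRight_shift e p

/-- This is the commutation rule for `X` read backwards, and the reason for building the skew
polynomials. -/
theorem isRightDerivation_shift : IsRightDerivation D (shift D A) := fun p e => by
  rw [smul_shift, sub_add_cancel]

end SkewPoly

/-- If every `D`-derivation preserves torsion on skew polynomials with coefficients in `E ⧸ I`,
then `D` maps some right ideal of the filter into `I`. -/
theorem RightGabrielFilter.exists_map_mem {E : Type u} [Ring E] (F : RightGabrielFilter E)
    (D : RingDerivation E) {I : Submodule Eᵐᵒᵖ E} (hI : I ∈ F.sets)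
    (h : ∀ p ∈ F.torsion (SkewPoly D (ULift.{w} (E ⧸ I))),
      SkewPoly.shift D _ p ∈ F.torsion (SkewPoly D (ULift.{w} (E ⧸ I)))) :
    ∃ J ∈ F.sets, ∀ t ∈ J, D t ∈ I := by
  -- The class of `1` has annihilator exactly `I`; the lift only places the module in the universe
  -- of the test modules.
  let a : ULift.{w} (E ⧸ I) := ⟨Submodule.Quotient.mk 1⟩
  have ha : ∀ t : E, op t • a = 0 ↔ t ∈ I := fun t => by
    rw [← Submodule.Quotient.mk_eq_zero I, ← ULift.down_inj]
    change Submodule.Quotient.mk (1 * t) = (0 : E ⧸ I) ↔ _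
    rw [one_mul]
  have hp : SkewPoly.monomial D _ 0 a ∈ F.torsion (SkewPoly D (ULift.{w} (E ⧸ I))) := by
    refine F.mem_of_le I hI _ fun t ht => ?_
    change op t • SkewPoly.monomial D _ 0 a = 0
    rw [SkewPoly.smul_monomial_zero, (ha t).2 ht, map_zero]
  -- The ideal `J` is the annihilator of `a X`.
  refine ⟨_, h _ hp, fun t ht => (ha _).1 ?_⟩
  have ht : op t • SkewPoly.shift D _ (SkewPoly.monomial D _ 0 a) = 0 := ht
  rw [SkewPoly.smul_shift, SkewPoly.smul_monomial_zero, SkewPoly.smul_monomial_zero,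
    SkewPoly.shift_monomial] at ht
  -- The constant coefficient of `(a t) X - a D(t) = 0` isolates `a D(t) = 0`.
  have h₀ := congrArg (SkewPoly.coeff D _ 0) ht
  rwa [map_sub, SkewPoly.coeff_monomial_of_ne (by decide), SkewPoly.coeff_monomial_self, map_zero,
    zero_sub, neg_eq_zero] at h₀

/-! ### Bimodule derivations as derivations of right modules over `R ⊗ Rᵒᵖ` -/

section Bridge

variable {R : Type*} [Ring R] (δ : RingDerivation R)

theorem RingDerivation.env_tmul_one (r : R) :
    δ.env (r ⊗ₜ[ℤ] (1 : Rᵐᵒᵖ)) = δ r ⊗ₜ[ℤ] (1 : Rᵐᵒᵖ) := by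
  change δ.envHom (r ⊗ₜ[ℤ] op 1) = _
  rw [envHom_tmul, map_one_eq_zero, MulOpposite.op_zero, TensorProduct.tmul_zero, add_zero,
    MulOpposite.op_one]

theorem RingDerivation.env_one_tmul (s : R) :
    δ.env ((1 : R) ⊗ₜ[ℤ] op s) = (1 : R) ⊗ₜ[ℤ] op (δ s) := by
  change δ.envHom ((1 : R) ⊗ₜ[ℤ] op s) = _
  rw [envHom_tmul, map_one_eq_zero, TensorProduct.zero_tmul, zero_add]

variable {δ} {X : Type*} [AddCommGroup X] [Module (Env R)ᵐᵒᵖ X] {d : X →+ X}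

/-- The Leibniz rule for the action of `R ⊗ Rᵒᵖ` can be checked on `r ⊗ 1` and `1 ⊗ s`. -/
theorem isRightDerivation_env
    (hr : ∀ x (r : R), d (op (r ⊗ₜ[ℤ] (1 : Rᵐᵒᵖ)) • x) =
      op (r ⊗ₜ[ℤ] (1 : Rᵐᵒᵖ)) • d x + op (δ r ⊗ₜ[ℤ] (1 : Rᵐᵒᵖ)) • x)
    (hl : ∀ x (s : R), d (op ((1 : R) ⊗ₜ[ℤ] op s) • x) =
      op ((1 : R) ⊗ₜ[ℤ] op s) • d x + op ((1 : R) ⊗ₜ[ℤ] op (δ s)) • x) :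
    IsRightDerivation δ.env d := by
  intro x t
  induction t using TensorProduct.induction_on with
  | zero =>
    have h : δ.env 0 = 0 := δ.env.map_zero'
    have h₀ : ∀ y : X, op (0 : Env R) • y = 0 := fun y => zero_smul (Env R)ᵐᵒᵖ y
    rw [h, h₀, h₀, map_zero, add_zero]
  | add t t' h h' =>
    have hD : δ.env (t + t') = δ.env t + δ.env t' := δ.env.map_add' t t'
    rw [hD, MulOpposite.op_add, MulOpposite.op_add, add_smul, add_smul, add_smul, map_add, h, h']
    abel
  | tmul r s =>
    induction s using MulOpposite.rec'
    rename_i s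
    have hD : δ.env ((r ⊗ₜ[ℤ] (1 : Rᵐᵒᵖ)) * ((1 : R) ⊗ₜ[ℤ] op s)) =
        δ.env (r ⊗ₜ[ℤ] (1 : Rᵐᵒᵖ)) * ((1 : R) ⊗ₜ[ℤ] op s) +
          (r ⊗ₜ[ℤ] (1 : Rᵐᵒᵖ)) * δ.env ((1 : R) ⊗ₜ[ℤ] op s) := δ.env.leibniz' _ _
    -- Pure tensors are products of the two kinds of generators, so the Leibniz rule of `δ.env`
    -- reduces them to `hr` and `hl`.
    have ht : r ⊗ₜ[ℤ] op s = (r ⊗ₜ[ℤ] (1 : Rᵐᵒᵖ)) * ((1 : R) ⊗ₜ[ℤ] op s) := by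
      rw [Algebra.TensorProduct.tmul_mul_tmul, mul_one, one_mul]
    rw [ht, hD, δ.env_tmul_one, δ.env_one_tmul]
    simp only [MulOpposite.op_mul, MulOpposite.op_add, add_smul, mul_smul]
    rw [hl, hr, smul_add]
    abel

theorem IsRightDerivation.env_right (h : IsRightDerivation δ.env d) (x : X) (r : R) :
    d (op (r ⊗ₜ[ℤ] (1 : Rᵐᵒᵖ)) • x) =
      op (r ⊗ₜ[ℤ] (1 : Rᵐᵒᵖ)) • d x + op (δ r ⊗ₜ[ℤ] (1 : Rᵐᵒᵖ)) • x := by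
  rw [h, δ.env_tmul_one]

theorem IsRightDerivation.env_left (h : IsRightDerivation δ.env d) (x : X) (s : R) :
    d (op ((1 : R) ⊗ₜ[ℤ] op s) • x) =
      op ((1 : R) ⊗ₜ[ℤ] op s) • d x + op ((1 : R) ⊗ₜ[ℤ] op (δ s)) • x := by
  rw [h, δ.env_one_tmul]

end Bridge

section AsRight

variable {R : Type*} [Ring R] {δ : RingDerivation R}
  {M : Type*} [AddCommGroup M] [Module R M] [Module Rᵐᵒᵖ M] [SMulCommClass R Rᵐᵒᵖ M]

theorem AsRight.tmul_one_smul (x : M) (r : R) :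
    (op (r ⊗ₜ[ℤ] (1 : Rᵐᵒᵖ)) : (Env R)ᵐᵒᵖ) • AsRight.of R M x = AsRight.of R M (op r • x) := by
  rw [← MulOpposite.op_one, AsRight.tmul_smul, one_smul]

theorem AsRight.one_tmul_smul (x : M) (s : R) :
    (op ((1 : R) ⊗ₜ[ℤ] op s) : (Env R)ᵐᵒᵖ) • AsRight.of R M x = AsRight.of R M (s • x) := by
  rw [AsRight.tmul_smul, MulOpposite.op_one, one_smul]

variable (R) in
/-- An additive map of `M` regarded as a map of the right module. -/
def AsRight.map (d : M →+ M) : AsRight R M →+ AsRight R M :=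
  (AsRight.of R M).toAddMonoidHom.comp (d.comp (AsRight.of R M).symm.toAddMonoidHom)

theorem IsBimoduleDerivation.isRightDerivation {d : M →+ M} (h : IsBimoduleDerivation δ d) :
    IsRightDerivation δ.env (AsRight.map R d) := by
  refine isRightDerivation_env (fun x r => ?_) fun x s => ?_ <;>
    obtain ⟨x, rfl⟩ := (AsRight.of R M).surjective x
  · change AsRight.map R d _ = _ • AsRight.of R M (d x) + _
    rw [AsRight.tmul_one_smul, AsRight.tmul_one_smul, AsRight.tmul_one_smul, ← map_add, ← h.right]
    rfl
  · change AsRight.map R d _ = _ • AsRight.of R M (d x) + _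
    rw [AsRight.one_tmul_smul, AsRight.one_tmul_smul, AsRight.one_tmul_smul, ← map_add, add_comm,
      ← h.left]
    rfl

end AsRight

/-! ### Existence and uniqueness of extensions for bimodules -/

section SymmetricQuotient

variable {R : Type*} [Ring R] {Fl : LeftGabrielFilter R} {Fr : RightGabrielFilter R}
  {δ : RingDerivation R}
  {M : Type*} [AddCommGroup M] [Module R M] [Module Rᵐᵒᵖ M] [SMulCommClass R Rᵐᵒᵖ M]
  {d : M →+ M}

theorem SymmetricQuotient.isBimoduleDerivation_iff
    {d' : SymmetricQuotient Fl Fr M →+ SymmetricQuotient Fl Fr M} :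
    IsBimoduleDerivation δ d' ↔ IsRightDerivation δ.env d' := by
  constructor
  · intro h
    refine isRightDerivation_env (fun x r => h.right x r) fun x s => ?_
    rw [add_comm]
    exact h.left s x
  · intro h
    refine ⟨fun x r => h.env_right x r, fun s x => ?_⟩
    rw [add_comm]
    exact h.env_left x s

theorem IsBimoduleDerivation.exists_isExtension (hd : IsBimoduleDerivation δ d)
    (hT : ∀ x ∈ symmetricTorsion Fl Fr M, d x ∈ symmetricTorsion Fl Fr M) :
    ∃ d', IsExtension Fl Fr δ d d' := by
  obtain ⟨d', h, hq⟩ := RightGabrielFilter.ModuleOfQuotients.exists_extension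
    (F := symmetricFilter Fl Fr) hd.isRightDerivation hT
  exact ⟨d', SymmetricQuotient.isBimoduleDerivation_iff.2 h, hq⟩

theorem IsExtension.unique {d₁ d₂ : SymmetricQuotient Fl Fr M →+ SymmetricQuotient Fl Fr M}
    (h₁ : IsExtension Fl Fr δ d d₁) (h₂ : IsExtension Fl Fr δ d d₂) : d₁ = d₂ := by
  have hr₁ := SymmetricQuotient.isBimoduleDerivation_iff.1 h₁.1
  have hr₂ := SymmetricQuotient.isBimoduleDerivation_iff.1 h₂.1
  have hsmul : ∀ (t : Env R) (y : SymmetricQuotient Fl Fr M),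
      d₁ (op t • y) - d₂ (op t • y) = op t • (d₁ y - d₂ y) := fun t y => by
    rw [hr₁, hr₂, smul_sub]
    abel
  ext y
  exact sub_eq_zero.1 (RightGabrielFilter.ModuleOfQuotients.eq_zero_of_comp_q_eq_zero
    (symmetricFilter Fl Fr) (N := AsRight R M) (h := fun y => d₁ y - d₂ y)
    hsmul (fun x => sub_eq_zero.2 ((h₁.2 x).trans (h₂.2 x).symm)) y)

/-- Torsion is the kernel of `q`, and `d' ∘ q = q ∘ d` forces `d` to preserve this kernel. -/
theorem IsExtension.map_mem_symmetricTorsion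
    {d' : SymmetricQuotient Fl Fr M →+ SymmetricQuotient Fl Fr M}
    (h : IsExtension Fl Fr δ d d') {x : M} (hx : x ∈ symmetricTorsion Fl Fr M) :
    d x ∈ symmetricTorsion Fl Fr M := by
  have hq : SymmetricQuotient.q Fl Fr M x = 0 :=
    (RightGabrielFilter.ModuleOfQuotients.q_eq_zero_iff (symmetricFilter Fl Fr)).2 hx
  have hq' : SymmetricQuotient.q Fl Fr M (d x) = 0 := by rw [← h.2 x, hq, map_zero]
  exact (RightGabrielFilter.ModuleOfQuotients.q_eq_zero_iff (N := AsRight R M)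
    (symmetricFilter Fl Fr)).1 hq'

theorem IsBimoduleDerivation.map_mem_symmetricTorsion (hF : IsDifferentialFilter Fl Fr)
    (hd : IsBimoduleDerivation δ d) {x : M} (hx : x ∈ symmetricTorsion Fl Fr M) :
    d x ∈ symmetricTorsion Fl Fr M :=
  (symmetricFilter Fl Fr).map_torsion_of_differential (hF δ) hd.isRightDerivation hx

end SymmetricQuotient

/-! ### Right modules over `R ⊗ Rᵒᵖ` as bimodules -/

section AsBimodule

variable (R : Type*) [Ring R] (X : Type*) [AddCommGroup X] [Module (Env R)ᵐᵒᵖ X]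

/-- The right `R ⊗ Rᵒᵖ`-module `X` regarded as an `R`-bimodule. -/
@[nolint unusedArguments]
def AsBimodule (_ : Type*) (X : Type*) : Type _ := X

namespace AsBimodule

instance : AddCommGroup (AsBimodule R X) := inferInstanceAs (AddCommGroup X)

instance : Module (Env R)ᵐᵒᵖ (AsBimodule R X) := inferInstanceAs (Module (Env R)ᵐᵒᵖ X)

instance : Module R (AsBimodule R X) :=
  Module.compHom _
    (((Algebra.TensorProduct.includeRight : Rᵐᵒᵖ →ₐ[ℤ] Env R).toRingHom.op).comp
      (RingEquiv.opOp R).toRingHom)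

instance : Module Rᵐᵒᵖ (AsBimodule R X) :=
  Module.compHom _ ((Algebra.TensorProduct.includeLeft : R →ₐ[ℤ] Env R).toRingHom.op)

variable {R X}

theorem left_smul_def (s : R) (x : AsBimodule R X) :
    s • x = (op ((1 : R) ⊗ₜ[ℤ] op s) : (Env R)ᵐᵒᵖ) • x := rfl

theorem right_smul_def (r : R) (x : AsBimodule R X) :
    op r • x = (op (r ⊗ₜ[ℤ] (1 : Rᵐᵒᵖ)) : (Env R)ᵐᵒᵖ) • x := rfl

instance : SMulCommClass R Rᵐᵒᵖ (AsBimodule R X) where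
  smul_comm s r x := by
    induction r using MulOpposite.rec'
    rw [left_smul_def, right_smul_def, right_smul_def, left_smul_def, ← mul_smul, ← mul_smul,
      ← MulOpposite.op_mul, ← MulOpposite.op_mul]
    simp [Algebra.TensorProduct.tmul_mul_tmul]

/-- Passing to the bimodule and back recovers the original action, because `r ⊗ s = (r ⊗ 1)(1 ⊗ s)`.
Hence the two notions of torsion coincide. -/
theorem smul_asRight (t : Env R) (x : AsBimodule R X) :
    op t • AsRight.of R (AsBimodule R X) x = AsRight.of R (AsBimodule R X) (op t • x) := by
  induction t using TensorProduct.induction_on with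
  | zero =>
    have h₀ : op (0 : Env R) • x = 0 := zero_smul (Env R)ᵐᵒᵖ x
    rw [h₀, map_zero]
    exact zero_smul (Env R)ᵐᵒᵖ (AsRight.of R (AsBimodule R X) x)
  | add t t' h h' => rw [MulOpposite.op_add, add_smul, add_smul, h, h', map_add]
  | tmul r s =>
    induction s using MulOpposite.rec'
    rw [AsRight.tmul_smul, left_smul_def, right_smul_def, ← mul_smul, ← MulOpposite.op_mul,
      Algebra.TensorProduct.tmul_mul_tmul, mul_one, one_mul]

theorem mem_symmetricTorsion_iff {Fl : LeftGabrielFilter R} {Fr : RightGabrielFilter R}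
    {x : AsBimodule R X} :
    x ∈ symmetricTorsion Fl Fr (AsBimodule R X) ↔
      x ∈ (symmetricFilter Fl Fr).torsion (AsBimodule R X) := by
  have h : RightGabrielFilter.rightAnn (AsRight.of R (AsBimodule R X) x) =
      RightGabrielFilter.rightAnn (E := Env R) x := by
    ext t
    change op t • AsRight.of R (AsBimodule R X) x = 0 ↔ op t • x = 0
    rw [smul_asRight, EmbeddingLike.map_eq_zero_iff]
  exact iff_of_eq (congrArg (· ∈ (symmetricFilter Fl Fr).sets) h)

theorem isBimoduleDerivation {δ : RingDerivation R} {d : AsBimodule R X →+ AsBimodule R X}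
    (h : IsRightDerivation δ.env d) : IsBimoduleDerivation δ d := by
  refine ⟨fun x r => h.env_right x r, fun s x => ?_⟩
  rw [add_comm]
  exact h.env_left x s

/-- A derivation of a right `R ⊗ Rᵒᵖ`-module preserves torsion if it has an extension. -/
theorem map_mem_torsion_of_exists_isExtension {Fl : LeftGabrielFilter R}
    {Fr : RightGabrielFilter R} {δ : RingDerivation R} {d : X →+ X}
    (hd : IsRightDerivation δ.env d)
    (h : ∀ d : AsBimodule R X →+ AsBimodule R X, IsBimoduleDerivation δ d →
      ∃ d', IsExtension Fl Fr δ d d') {x : X} (hx : x ∈ (symmetricFilter Fl Fr).torsion X) :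
    d x ∈ (symmetricFilter Fl Fr).torsion X := by
  obtain ⟨d', hd'⟩ := h d (isBimoduleDerivation hd)
  exact mem_symmetricTorsion_iff.1 (hd'.map_mem_symmetricTorsion (mem_symmetricTorsion_iff.2 hx))

end AsBimodule

end AsBimodule

end

/-! ### The theorem -/

theorem mainTheorem1 {R : Type u} [Ring R] (Fl : LeftGabrielFilter R)
    (Fr : RightGabrielFilter R) :
    (∀ (M : Type w) [AddCommGroup M] [Module R M] [Module Rᵐᵒᵖ M] [SMulCommClass R Rᵐᵒᵖ M]
      (δ : RingDerivation R) (d : M →+ M), IsBimoduleDerivation δ d →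
        (symmetricTorsion Fl Fr M = ⊥ → ∃ d', IsExtension Fl Fr δ d d') ∧
        ((∀ x ∈ symmetricTorsion Fl Fr M, d x ∈ symmetricTorsion Fl Fr M) →
          ∃ d', IsExtension Fl Fr δ d d') ∧
        (∀ d₁ d₂, IsExtension Fl Fr δ d d₁ → IsExtension Fl Fr δ d d₂ → d₁ = d₂)) ∧
    (IsDifferentialFilter Fl Fr ↔
      ∀ (M : Type (max u w)) [AddCommGroup M] [Module R M] [Module Rᵐᵒᵖ M]
        [SMulCommClass R Rᵐᵒᵖ M] (δ : RingDerivation R) (d : M →+ M),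
        IsBimoduleDerivation δ d → ∃! d', IsExtension Fl Fr δ d d') := by
  refine ⟨fun M _ _ _ _ δ d hd => ⟨fun hM => hd.exists_isExtension fun x hx => ?_,
    hd.exists_isExtension, fun _ _ => IsExtension.unique⟩, fun hF M _ _ _ _ δ d hd => ?_,
    fun h δ I hI => ?_⟩
  · rw [hM, AddSubgroup.mem_bot] at hx
    rw [hx, map_zero]
    exact zero_mem _
  · obtain ⟨d', hd'⟩ := hd.exists_isExtension (Fl := Fl) (Fr := Fr) fun _ =>
      hd.map_mem_symmetricTorsion hF
    exact ⟨d', hd', fun _ h => h.unique hd'⟩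
  -- Only existence of extensions is used here, applied to multiplication by `X` on skew polynomials
  -- over `Env R ⧸ I`.
  · refine RightGabrielFilter.exists_map_mem.{u, w} _ δ.env hI fun p hp => ?_
    exact AsBimodule.map_mem_torsion_of_exists_isExtension SkewPoly.isRightDerivation_shift
      (fun d hd => (h _ δ d hd).exists) hp
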